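/- For $p>0$ and $x=(x_1,x_2)\in\mathbb{R}^2$ write $|x|_p=(|x_1|^p+|x_2|^p)^{1/p}$. For $\beta>-1$, $s>0$ and $x\in\mathbb{R}^2$ put $$D_\beta^{[p]}(s:x)=\frac{1}{\Gamma(\beta+1)}\sum_{m\in\mathbb{Z}^2,\ |m|_p^p<s}(s-|m|_p^p)^\beta e^{2\pi i x\cdot m},\qquad \mathcal{D}_\beta^{[p]}(s:x)=\frac{1}{\Gamma(\beta+1)}\int_{|\xi|_p^p<s}(s-|\xi|_p^p)^\beta e^{2\pi i x\cdot \xi}\,d\xi .$$ For $\eta\in\mathbb{R}^2$ and $\omega>0$ define the generalized Bessel functions $$J_0^{[p]}(\eta)=\frac{1}{\Gamma(1/p)^2}\Bigl(\frac2p\Bigr)^2\int_0^1\cos(\eta_1t^{1/p})\cos(\eta_2(1-t)^{1/p})\,t^{\frac1p-1}(1-t)^{\frac1p-1}\,dt,$$ $$J_\omega^{[p]}(\eta)=\frac{|\eta|_p^\omega}{p^{\omega-1}\Gamma(\omega)}\int_0^1J_0^{[p]}(\tau\eta)\,\tau(1-\tau^p)^{\omega-1}\,d\tau .$$ Theorem.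 Let $p>0$ and $\beta>-1$, and suppose that $x\mapsto\mathcal{D}_\beta^{[p]}(1:x)$ is integrable on $\mathbb{R}^2$. Then for all $s>0$ and all $x\in\mathbb{R}^2$ the series below converges unconditionally and $$D_\beta^{[p]}(s:x)-\mathcal{D}_\beta^{[p]}(s:x)=s^{\beta+\frac2p}\,p^{\beta+1}\,\Gamma\Bigl(\frac1p\Bigr)^2\sum_{n\in\mathbb{Z}^2\setminus\{0\}}\frac{J_{\beta+1}^{[p]}\bigl(2\pi s^{1/p}(x-n)\bigr)}{\bigl(2\pi s^{1/p}|x-n|_p\bigr)^{\beta+1}},$$ where, if $x\in\mathbb{Z}^2\setminus\{0\}$, the term with $n=x$ is understood as the limit of the quotient $J_{\beta+1}^{[p]}(2\pi s^{1/p}y)/(2\pi s^{1/p}|y|_p)^{\beta+1}$ as $y\to0$, $y\neq0$. In particular, for every $s>0$ the series converges absolutely for every $x\in\left(-\frac12,\frac12\right]^2$. -/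

import Mathlib

open MeasureTheory Filter Topology

noncomputable section

/-- The plane `ℝ²`. -/
abbrev Plane : Type := EuclideanSpace ℝ (Fin 2)

/-- An integer vector `n ∈ ℤ²`, regarded as a point of the plane. -/
def latticePoint (n : Fin 2 → ℤ) : Plane := WithLp.toLp 2 (fun i => (n i : ℝ))

/-- The `p`-norm `|x|_p = (|x₁|^p + |x₂|^p)^(1/p)`, for any real `p > 0`. -/
def pNorm (p : ℝ) (x : Plane) : ℝ := (|x 0| ^ p + |x 1| ^ p) ^ (1 / p)

/-- The character `e^{2 π i x · y}`. -/
def planeExp (x y : Plane) : ℂ :=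
  Complex.exp (2 * (Real.pi : ℂ) * Complex.I * ((inner ℝ x y : ℝ) : ℂ))

/-- `D_β^{[p]}(s : x)`, the (finite) sum over the lattice points with `|m|_p^p < s`. -/
def latticeD (p β s : ℝ) (x : Plane) : ℂ :=
  (1 / (Real.Gamma (β + 1) : ℂ)) *
    ∑' m : {m : Fin 2 → ℤ // pNorm p (latticePoint m) ^ p < s},
      (((s - pNorm p (latticePoint m) ^ p) ^ β : ℝ) : ℂ) * planeExp x (latticePoint m)

/-- `𝒟_β^{[p]}(s : x)`, the integral over the region `|ξ|_p^p < s`. -/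
def integralD (p β s : ℝ) (x : Plane) : ℂ :=
  (1 / (Real.Gamma (β + 1) : ℂ)) *
    ∫ ξ in {ξ : Plane | pNorm p ξ ^ p < s},
      (((s - pNorm p ξ ^ p) ^ β : ℝ) : ℂ) * planeExp x ξ

/-- The generalized Bessel function `J_0^{[p]}` of order zero. -/
def genBesselZero (p : ℝ) (η : Plane) : ℝ :=
  1 / Real.Gamma (1 / p) ^ 2 * (2 / p) ^ 2 *
    ∫ t in (0 : ℝ)..1,
      Real.cos (η 0 * t ^ (1 / p)) * Real.cos (η 1 * (1 - t) ^ (1 / p)) *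
        t ^ (1 / p - 1) * (1 - t) ^ (1 / p - 1)

open Classical in
/-- The generalized Bessel function `J_ω^{[p]}` of order `ω ≥ 0`. -/
def genBessel (p ω : ℝ) (η : Plane) : ℝ :=
  if 0 < ω then
    pNorm p η ^ ω / (p ^ (ω - 1) * Real.Gamma ω) *
      ∫ τ in (0 : ℝ)..1, genBesselZero p (τ • η) * τ * (1 - τ ^ p) ^ (ω - 1)
  else genBesselZero p η

/-- The quotient `J_ω^{[p]}(2 π s^{1/p} y) / (2 π s^{1/p} |y|_p)^ω`, meaningful for `y ≠ 0`. -/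
def besselQuotient (p ω s : ℝ) (y : Plane) : ℝ :=
  genBessel p ω ((2 * Real.pi * s ^ (1 / p)) • y) /
    (2 * Real.pi * s ^ (1 / p) * pNorm p y) ^ ω

open Classical in
/-- The same quotient, with its value at `y = 0` defined by the limit `y → 0`, `y ≠ 0`. -/
def besselQuotientExt (p ω s : ℝ) : Plane → ℝ :=
  Function.update (besselQuotient p ω s) 0
    (limUnder (𝓝[≠] (0 : Plane)) (besselQuotient p ω s))

/-- The torus `(-1/2, 1/2]²`. -/
def torusSquare : Set Plane := {x | ∀ i, x i ∈ Set.Ioc (-(1 / 2) : ℝ) (1 / 2)}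

end

open scoped FourierTransform SchwartzMap ContDiff ENNReal

/-! The identity is Poisson summation for the weight w_s(ξ) = (s - |ξ|_p^p)_+^β / Γ(β+1). If F is
its inverse Fourier transform, then `integralD` is F(x), `latticeD` is ∑ w_s(m) e^{2πi x·m}, and the
Bessel quotients are, up to the constant in front, the values F(x - n). The term n = 0 is the one
moved to the left.

Integrability of F is the essential hypothesis. It forces β > 0
(`pos_of_integrable_fourierInv_planeWeight`): inversion gives w_1 a continuous representative, but
for β ≤ 0 the weight stays away from 0 just inside the unit p-sphere. So w_s is continuous with
compact support. Poisson summation then needs no pointwise decay of F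
(`poisson_summation_of_hasCompactSupport`): with χ Schwartz, χ⊗χ = 1 on the support and g = 𝓕⁻ χ,
one has F = F * (g⊗g). Hence ∑ |F(x - n)| ≤ C²‖F‖₁, and everything reduces to one-dimensional
Poisson summation for g.

The link with Bessel functions is `fourierInv_planeWeight`, a computation in coordinates adapted to
the p-norm, together with scaling in s. -/

/-! ### Schwartz cut-offs and one-dimensional lattice sums -/

theorem exists_schwartz_eq_one (R : ℝ) :
    ∃ χ : 𝓢(ℝ, ℂ), HasCompactSupport χ ∧ ∀ t, |t| ≤ R → χ t = 1 := by
  let b : ContDiffBump (0 : ℝ) := ⟨|R| + 1, |R| + 2, by positivity, by linarith⟩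
  have h1 : HasCompactSupport (fun t : ℝ => ((b t : ℝ) : ℂ)) :=
    b.hasCompactSupport.comp_left (g := fun r : ℝ => (r : ℂ)) (by simp)
  have h2 : ContDiff ℝ ∞ (fun t : ℝ => ((b t : ℝ) : ℂ)) :=
    Complex.ofRealCLM.contDiff.comp b.contDiff
  refine ⟨h1.toSchwartzMap h2, by simpa using! h1, fun t ht => ?_⟩
  have : b t = 1 := b.one_of_mem_closedBall (by
    simp only [Metric.mem_closedBall, dist_zero_right, Real.norm_eq_abs, b]
    linarith [le_abs_self R])
  simpa using this

theorem SchwartzMap.exists_norm_le_div (g : 𝓢(ℝ, ℂ)) :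
    ∃ C, 0 ≤ C ∧ ∀ x, ‖g x‖ ≤ C / (1 + x ^ 2) := by
  obtain ⟨A, -, hA⟩ := g.decay 0 0
  obtain ⟨B, -, hB⟩ := g.decay 2 0
  have key : ∀ x, ‖g x‖ ≤ (A + B) / (1 + x ^ 2) := by
    intro x
    have h1 := hA x
    have h2 := hB x
    simp only [pow_zero, one_mul, norm_iteratedFDeriv_zero, Real.norm_eq_abs, sq_abs] at h1 h2
    rw [le_div_iff₀ (by positivity)]
    linarith
  refine ⟨A + B, ?_, key⟩
  have := (norm_nonneg _).trans (key 0)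
  simpa using this

theorem SchwartzMap.exists_tsum_norm_le (g : 𝓢(ℝ, ℂ)) :
    ∃ C, ∀ x : ℝ, Summable (fun k : ℤ => ‖g (x - k)‖) ∧ ∑' k : ℤ, ‖g (x - k)‖ ≤ C := by
  obtain ⟨C, hC, hg⟩ := g.exists_norm_le_div
  have hs : Summable (fun k : ℤ => 3 * C / (1 + (k : ℝ) ^ 2)) := by
    have h0 : Summable (fun k : ℤ => 1 / (k : ℝ) ^ 2) := by
      simpa using! Real.summable_one_div_int_pow.2 one_lt_two
    refine Summable.of_norm_bounded_eventually (h0.mul_left (3 * C)) ?_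
    -- The comparison with 1/k² fails at k = 0, where that quotient is 0 by convention.
    have : ∀ᶠ k : ℤ in cofinite, k ≠ 0 := by
      simpa using! (Set.finite_singleton (0 : ℤ)).compl_mem_cofinite
    filter_upwards [this] with k hk
    have hk' : (k : ℝ) ≠ 0 := by exact_mod_cast hk
    rw [Real.norm_of_nonneg (by positivity), mul_one_div]
    gcongr
    linarith
  refine ⟨∑' k : ℤ, 3 * C / (1 + (k : ℝ) ^ 2), fun x => ?_⟩
  have hle : ∀ k : ℤ, ‖g (x - k)‖ ≤ 3 * C / (1 + (((⌊x⌋ - k : ℤ)) : ℝ) ^ 2) := by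
    intro k
    refine (hg _).trans ?_
    rw [div_le_div_iff₀ (by positivity) (by positivity)]
    have h1 := Int.floor_le x
    have h2 := Int.lt_floor_add_one x
    push_cast
    set m : ℝ := (⌊x⌋ : ℝ)
    -- Since 0 ≤ x - m ≤ 1, (m - k)² ≤ 2(x - k)² + 2. Replacing x by its floor makes the bound a
    -- reindexing of one fixed series, hence uniform in x.
    have : 1 + (m - k) ^ 2 ≤ 3 * (1 + (x - k) ^ 2) := by
      nlinarith [sq_nonneg ((x - k) + (x - m)), sq_nonneg (x - k), mul_nonneg (sub_nonneg.2 h1)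
        (sub_nonneg.2 h2.le)]
    nlinarith
  have hs' : Summable (fun k : ℤ => 3 * C / (1 + (((⌊x⌋ - k : ℤ)) : ℝ) ^ 2)) :=
    (Equiv.subLeft ⌊x⌋).summable_iff.2 hs
  have hsum := hs'.of_nonneg_of_le (fun k => norm_nonneg _) hle
  refine ⟨hsum, (hsum.tsum_le_tsum hle hs').trans (le_of_eq ?_)⟩
  exact (Equiv.subLeft ⌊x⌋).tsum_eq (fun k : ℤ => 3 * C / (1 + (k : ℝ) ^ 2))

/-- The sum over `ℤ²` of a tensor product. -/
theorem hasSum_fin_two_mul {𝕜 : Type*} [RCLike 𝕜] {a b : ℤ → 𝕜} (ha : Summable fun k => ‖a k‖)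
    (hb : Summable fun k => ‖b k‖) :
    HasSum (fun n : Fin 2 → ℤ => a (n 0) * b (n 1)) ((∑' k, a k) * ∑' k, b k) := by
  have h := ha.of_norm.hasSum.mul hb.of_norm.hasSum (summable_mul_of_summable_norm ha hb)
  exact (finTwoArrowEquiv ℤ).hasSum_iff.2 h

/-- Poisson summation for the inverse Fourier transform of a Schwartz function. -/
theorem SchwartzMap.tsum_fourierInv_sub (χ : 𝓢(ℝ, ℂ)) (x : ℝ) :
    ∑' k : ℤ, (𝓕⁻ χ) (x - k) = ∑' k : ℤ, χ k * fourier k (x : UnitAddCircle) := by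
  have h := (𝓕⁻ χ).tsum_eq_tsum_fourier x
  rw [FourierTransform.fourier_fourierInv_eq] at h
  rw [← h, ← (Equiv.neg ℤ).tsum_eq]
  simp [sub_eq_add_neg]

/-! ### Characters and product integrals on the plane -/

theorem inner_plane (x y : Plane) : inner ℝ x y = x 0 * y 0 + x 1 * y 1 := by
  simp [PiLp.inner_apply, Fin.sum_univ_two, mul_comm]

theorem planeExp_eq_mul (x y : Plane) :
    planeExp x y = Complex.exp (2 * Real.pi * Complex.I * (x 0 * y 0)) *
      Complex.exp (2 * Real.pi * Complex.I * (x 1 * y 1)) := by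
  rw [planeExp, ← Complex.exp_add, inner_plane]
  push_cast
  ring_nf

theorem norm_planeExp (x y : Plane) : ‖planeExp x y‖ = 1 := by
  rw [planeExp, show 2 * (Real.pi : ℂ) * Complex.I * ((inner ℝ x y : ℝ) : ℂ) =
    ((2 * Real.pi * inner ℝ x y : ℝ) : ℂ) * Complex.I by push_cast; ring]
  exact Complex.norm_exp_ofReal_mul_I _

theorem planeExp_add_left (x y z : Plane) : planeExp (x + y) z = planeExp x z * planeExp y z := by
  rw [planeExp, planeExp, planeExp, ← Complex.exp_add, inner_add_left]
  push_cast
  ring_nf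

@[fun_prop]
theorem continuous_planeExp (x : Plane) : Continuous (planeExp x) := by
  unfold planeExp
  fun_prop

theorem fourierInv_plane (f : Plane → ℂ) (x : Plane) :
    𝓕⁻ f x = ∫ ξ, f ξ * planeExp x ξ := by
  rw [Real.fourierInv_eq']
  refine integral_congr_ae (Eventually.of_forall fun ξ => ?_)
  simp only [smul_eq_mul, planeExp]
  rw [mul_comm, real_inner_comm]
  push_cast
  ring_nf

theorem fourier_plane (f : Plane → ℂ) (x : Plane) :
    𝓕 f x = ∫ ξ, f ξ * planeExp (-x) ξ := by
  rw [← fourierInv_plane, Real.fourierInv_eq_fourier_neg, neg_neg]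

theorem measurePreserving_plane :
    MeasurePreserving (fun z : Plane => (z 0, z 1)) volume (volume : Measure (ℝ × ℝ)) :=
  (volume_preserving_finTwoArrow ℝ).comp
    (EuclideanSpace.volume_preserving_symm_measurableEquiv_toLp (Fin 2))

theorem measurableEmbedding_plane :
    MeasurableEmbedding (fun z : Plane => (z 0, z 1)) :=
  (MeasurableEquiv.finTwoArrow (α := ℝ)).measurableEmbedding.comp
    (MeasurableEquiv.toLp 2 (Fin 2 → ℝ)).symm.measurableEmbedding

theorem integral_plane {E : Type*} [NormedAddCommGroup E] [NormedSpace ℝ E] (f : ℝ × ℝ → E) :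
    ∫ z : Plane, f (z 0, z 1) = ∫ q, f q :=
  measurePreserving_plane.integral_comp measurableEmbedding_plane f

theorem integrable_plane_iff {E : Type*} [NormedAddCommGroup E] (f : ℝ × ℝ → E) :
    Integrable (fun z : Plane => f (z 0, z 1)) ↔ Integrable f :=
  measurePreserving_plane.integrable_comp_emb measurableEmbedding_plane

theorem integral_plane_mul (a b : ℝ → ℂ) :
    ∫ z : Plane, a (z 0) * b (z 1) = (∫ t, a t) * ∫ t, b t := by
  rw [integral_plane (fun q : ℝ × ℝ => a q.1 * b q.2)]
  exact integral_prod_mul a b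

theorem integrable_plane_mul {a b : ℝ → ℂ} (ha : Integrable a) (hb : Integrable b) :
    Integrable (fun z : Plane => a (z 0) * b (z 1)) :=
  (integrable_plane_iff (fun q : ℝ × ℝ => a q.1 * b q.2)).2 (ha.mul_prod hb)

theorem fourierInv_plane_mul (χ : 𝓢(ℝ, ℂ)) (x : Plane) :
    ∫ ξ : Plane, χ (ξ 0) * χ (ξ 1) * planeExp x ξ = (𝓕⁻ χ) (x 0) * (𝓕⁻ χ) (x 1) := by
  have h (t : ℝ) : (𝓕⁻ χ) t =
      ∫ v : ℝ, χ v * Complex.exp (2 * Real.pi * Complex.I * (t * v)) := by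
    rw [SchwartzMap.fourierInv_coe, Real.fourierInv_eq']
    refine integral_congr_ae (Eventually.of_forall fun v => ?_)
    simp only [smul_eq_mul, RCLike.inner_apply, conj_trivial]
    push_cast
    ring_nf
  rw [h, h, ← integral_plane_mul]
  refine integral_congr_ae (Eventually.of_forall fun v => ?_)
  simp only [planeExp_eq_mul]
  ring

/-! ### Poisson summation for band-limited functions -/

/-- A band-limited function is reproduced by convolution with the inverse Fourier transform of a
function that is one on its spectrum. -/
theorem fourierInv_eq_convolution {f : Plane → ℂ} (hc : Continuous f) (hs : HasCompactSupport f)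
    (hF : Integrable (𝓕⁻ f)) {χ : 𝓢(ℝ, ℂ)} (hχ : ∀ ξ, f ξ * (χ (ξ 0) * χ (ξ 1)) = f ξ)
    (x : Plane) :
    𝓕⁻ f x = ∫ y, 𝓕⁻ f y * ((𝓕⁻ χ) (x 0 - y 0) * (𝓕⁻ χ) (x 1 - y 1)) := by
  have hf : Integrable f := hc.integrable_of_hasCompactSupport hs
  have hF' : Integrable (𝓕 f) := by
    have := hF.comp_neg
    simpa [Real.fourierInv_eq_fourier_neg] using this
  have hinv : 𝓕 (𝓕⁻ f) = f := hc.fourier_fourierInv_eq hf hF'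
  have hX : Integrable (fun ξ : Plane => χ (ξ 0) * χ (ξ 1) * planeExp x ξ) := by
    refine (integrable_plane_mul χ.integrable χ.integrable).mul_bdd (c := 1)
      (by fun_prop) ?_
    exact Eventually.of_forall fun ξ => (norm_planeExp x ξ).le
  -- Move the Fourier transform from 𝓕⁻ f onto χ⊗χ · e^{2πi x·ξ}, whose transform at y is (g⊗g)(x -
  -- y) with g = 𝓕⁻ χ.
  have key := VectorFourier.integral_fourierIntegral_smul_eq_flip (L := innerₗ Plane)
      (μ := volume) (ν := volume) Real.continuous_fourierChar continuous_inner hF hX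
  have e1 : ∀ ξ, VectorFourier.fourierIntegral Real.fourierChar volume (innerₗ Plane) (𝓕⁻ f) ξ
      = f ξ := fun ξ => congrFun hinv ξ
  have e2 : ∀ y, VectorFourier.fourierIntegral Real.fourierChar volume (innerₗ Plane).flip
      (fun ξ : Plane => χ (ξ 0) * χ (ξ 1) * planeExp x ξ) y =
      (𝓕⁻ χ) (x 0 - y 0) * (𝓕⁻ χ) (x 1 - y 1) := by
    intro y
    rw [flip_innerₗ]
    refine (fourier_plane _ y).trans ?_
    have := fourierInv_plane_mul χ (x - y)
    simp only [PiLp.sub_apply] at this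
    rw [← this, sub_eq_add_neg]
    refine integral_congr_ae (Eventually.of_forall fun v => ?_)
    simp only [planeExp_add_left]
    ring
  simp only [e1, e2, smul_eq_mul] at key
  rw [← key, fourierInv_plane]
  refine integral_congr_ae (Eventually.of_forall fun v => ?_)
  simp only
  rw [← mul_assoc, hχ]

/-- The cut-off is a tensor product, not radial, so that sums over ℤ² of its transform factor into
one-dimensional ones. -/
theorem exists_schwartz_mul_eq {f : Plane → ℂ} (hs : HasCompactSupport f) :
    ∃ χ : 𝓢(ℝ, ℂ), HasCompactSupport χ ∧ ∀ ξ, f ξ * (χ (ξ 0) * χ (ξ 1)) = f ξ := by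
  obtain ⟨R, hR⟩ := hs.isCompact.isBounded.exists_norm_le
  obtain ⟨χ, h1, h2⟩ := exists_schwartz_eq_one R
  refine ⟨χ, h1, fun ξ => ?_⟩
  by_cases h : f ξ = 0
  · simp [h]
  · have hn := hR ξ (subset_tsupport f h)
    have hi (i : Fin 2) : χ (ξ i) = 1 := h2 _ ((PiLp.norm_apply_le ξ i).trans hn)
    simp [hi]

/-- **Poisson summation** for a band-limited integrable function on the plane. -/
theorem poisson_summation_of_hasCompactSupport {f : Plane → ℂ} (hc : Continuous f)
    (hs : HasCompactSupport f) (hF : Integrable (𝓕⁻ f)) (x : Plane) :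
    Summable (fun n : Fin 2 → ℤ => ‖𝓕⁻ f (x - latticePoint n)‖) ∧
    ∑' n : Fin 2 → ℤ, 𝓕⁻ f (x - latticePoint n) =
      ∑' m : Fin 2 → ℤ, f (latticePoint m) * planeExp x (latticePoint m) := by
  obtain ⟨χ, hχc, hχ⟩ := exists_schwartz_mul_eq hs
  obtain ⟨C, hC⟩ := (𝓕⁻ χ).exists_tsum_norm_le
  set g : 𝓢(ℝ, ℂ) := 𝓕⁻ χ with hg
  set F := 𝓕⁻ f with hFdef
  have hinv : 𝓕 F = f := hc.fourier_fourierInv_eq (hc.integrable_of_hasCompactSupport hs) (by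
    have := hF.comp_neg
    simpa [hFdef, Real.fourierInv_eq_fourier_neg] using this)
  let H : (Fin 2 → ℤ) → Plane → ℂ := fun n y =>
    F y * (g (x 0 - y 0 - n 0) * g (x 1 - y 1 - n 1))
  have hconv : ∀ n, F (x - latticePoint n) = ∫ y, H n y := by
    intro n
    rw [hFdef, fourierInv_eq_convolution hc hs hF hχ]
    refine integral_congr_ae (Eventually.of_forall fun v => ?_)
    simp only [H, latticePoint, PiLp.sub_apply, ← hg, sub_right_comm _ _ (v _)]
    rfl
  have hC0 : 0 ≤ C := (tsum_nonneg fun _ => norm_nonneg _).trans (hC 0).2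
  have hH : ∀ n, Integrable (H n) := by
    intro n
    have hD' : ∀ t, ‖g t‖ ≤ ‖g.toBoundedContinuousFunction‖ := fun t =>
      g.toBoundedContinuousFunction.norm_coe_le_norm t
    refine hF.mul_bdd (c := ‖g.toBoundedContinuousFunction‖ * ‖g.toBoundedContinuousFunction‖)
      (by fun_prop) ?_
    refine Eventually.of_forall fun y => ?_
    rw [norm_mul]
    exact mul_le_mul (hD' _) (hD' _) (norm_nonneg _) (norm_nonneg _)
  have hpt (y : Plane) : HasSum (fun n => ‖H n y‖)
      (‖F y‖ * ((∑' k : ℤ, ‖g (x 0 - y 0 - k)‖) * ∑' k : ℤ, ‖g (x 1 - y 1 - k)‖)) := by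
    simp only [H, norm_mul]
    refine HasSum.mul_left _ (hasSum_fin_two_mul (a := fun k : ℤ => ‖g (x 0 - y 0 - k)‖)
      (b := fun k : ℤ => ‖g (x 1 - y 1 - k)‖) ?_ ?_)
    · simpa using (hC (x 0 - y 0)).1
    · simpa using (hC (x 1 - y 1)).1
  -- Sum under the integral first: the kernel sums are at most C² uniformly in y, leaving C²‖F‖₁.
  -- This gives both absolute convergence and the interchange below.
  have hsum : Summable fun n => ∫ y, ‖H n y‖ := by
    refine summable_of_sum_le (c := ∫ y, ‖F y‖ * (C * C))
      (fun n => integral_nonneg fun y => norm_nonneg _) fun u => ?_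
    rw [← integral_finsetSum _ fun n _ => (hH n).norm]
    refine integral_mono (integrable_finsetSum _ fun n _ => (hH n).norm)
      (hF.norm.mul_const _) fun y => ?_
    refine ((hpt y).summable.sum_le_tsum u fun n _ => norm_nonneg _).trans ?_
    rw [(hpt y).tsum_eq]
    have h1 := (hC (x 0 - y 0)).2
    have h2 := (hC (x 1 - y 1)).2
    gcongr
  refine ⟨hsum.of_nonneg_of_le (fun _ => norm_nonneg _) fun n => ?_, ?_⟩
  · rw [hconv]
    exact norm_integral_le_integral_norm _
  have h1 := hasSum_integral_of_summable_integral_norm hH hsum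
  simp only [hconv]
  rw [h1.tsum_eq]
  have hfin : (Function.support fun k : ℤ => χ k).Finite := by
    have := Int.tendsto_coe_cofinite.eventually hχc.compl_mem_cocompact
    refine Set.Finite.subset (s := {k : ℤ | ¬ (k : ℝ) ∈ (tsupport χ)ᶜ}) this fun k hk => ?_
    simpa using subset_tsupport (χ : ℝ → ℂ) hk
  have hfin2 : ∀ t : ℝ, Summable fun k : ℤ => ‖χ k * fourier k (t : UnitAddCircle)‖ := by
    intro t
    refine summable_of_hasFiniteSupport (hfin.subset fun k hk => ?_)
    contrapose! hk
    simp at hk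
    simp [hk]
  have hfourier (z : ℝ) (n : ℤ) : Complex.exp (2 * Real.pi * Complex.I * (z * n)) =
      fourier n (z : UnitAddCircle) := by
    rw [fourier_coe_apply]
    congr 1
    push_cast
    ring
  -- For fixed y, Poisson summation in each variable turns the kernel sum into a trigonometric
  -- polynomial, finite because χ has compact support.
  have hinner (y : Plane) : HasSum (fun n => H n y) (∑' m : Fin 2 → ℤ,
      F y * (χ (m 0) * χ (m 1) * planeExp (x - y) (latticePoint m))) := by
    have hA := hasSum_fin_two_mul (a := fun k : ℤ => g (x 0 - y 0 - k))
      (b := fun k : ℤ => g (x 1 - y 1 - k)) (hC (x 0 - y 0)).1 (hC (x 1 - y 1)).1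
    have hB := hasSum_fin_two_mul (hfin2 (x 0 - y 0)) (hfin2 (x 1 - y 1))
    rw [hg, χ.tsum_fourierInv_sub, χ.tsum_fourierInv_sub, ← hB.tsum_eq] at hA
    convert! hA.mul_left (F y) using 1
    rw [tsum_mul_left]
    congr 1
    refine tsum_congr fun m => ?_
    rw [planeExp_eq_mul]
    simp only [latticePoint, PiLp.sub_apply]
    rw [← hfourier, ← hfourier]
    push_cast
    ring
  have hfinS : {m : Fin 2 → ℤ | χ (m 0) * χ (m 1) ≠ 0}.Finite := by
    refine ((Set.Finite.pi' fun _ : Fin 2 => hfin)).subset fun m hm => ?_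
    simp only [Set.mem_ofPred_eq, mul_ne_zero_iff] at hm
    intro i
    fin_cases i
    exacts [hm.1, hm.2]
  set S := hfinS.toFinset
  have hS : ∀ m ∉ S, χ (m 0) * χ (m 1) = 0 := by
    intro m hm
    simpa [S, -mul_eq_zero] using hm
  have hint : ∀ m : Fin 2 → ℤ, Integrable
      (fun y => F y * planeExp (-y) (latticePoint m)) := by
    intro m
    refine hF.mul_bdd (c := 1) ?_ (Eventually.of_forall fun y => (norm_planeExp _ _).le)
    unfold planeExp
    fun_prop
  calc ∫ y, ∑' n, H n y = ∫ y, ∑ m ∈ S, χ (m 0) * χ (m 1) * planeExp x (latticePoint m) *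
        (F y * planeExp (-y) (latticePoint m)) := by
        refine integral_congr_ae (Eventually.of_forall fun y => ?_)
        simp only
        rw [(hinner y).tsum_eq, tsum_eq_sum (s := S) (fun m hm => by rw [hS m hm]; simp)]
        refine Finset.sum_congr rfl fun m _ => ?_
        rw [sub_eq_add_neg, planeExp_add_left]
        ring
    _ = ∑ m ∈ S, χ (m 0) * χ (m 1) * planeExp x (latticePoint m) * f (latticePoint m) := by
        rw [integral_finsetSum _ fun m _ => (hint m).const_mul _]
        refine Finset.sum_congr rfl fun m _ => ?_
        rw [integral_const_mul]
        congr 1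
        -- The coefficient of frequency m is 𝓕 F at m, which is f(m) by inversion.
        conv_rhs => rw [← hinv, fourier_plane]
        refine integral_congr_ae (Eventually.of_forall fun y => ?_)
        simp only [planeExp, inner_neg_left, real_inner_comm]
    _ = ∑ m ∈ S, f (latticePoint m) * planeExp x (latticePoint m) := by
        refine Finset.sum_congr rfl fun m _ => ?_
        conv_rhs => rw [← hχ]
        simp only [latticePoint]
        ring
    _ = _ := by
        refine (tsum_eq_sum fun m hm => ?_).symm
        rw [← hχ]
        have := hS m hm
        simp only [latticePoint]
        rw [this]
        simp

/-! ### Polar coordinates for the p-norm -/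

open Set

/-- Polar-type coordinates `(τ, t) ↦ (τ t^{1/p}, τ (1-t)^{1/p})` adapted to the `p`-norm. -/
noncomputable def pPolar (p : ℝ) (z : ℝ × ℝ) : ℝ × ℝ := (z.1 * z.2 ^ (1 / p), z.1 * (1 - z.2) ^ (1 / p))

/-- The derivative of `pPolar`. -/
noncomputable def fderivPPolar (p : ℝ) (z : ℝ × ℝ) : ℝ × ℝ →L[ℝ] ℝ × ℝ :=
  (Matrix.toLin (.finTwoProd ℝ) (.finTwoProd ℝ)
    !![z.2 ^ (1 / p), z.1 * (1 / p * z.2 ^ (1 / p - 1));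
      (1 - z.2) ^ (1 / p), -(z.1 * (1 / p * (1 - z.2) ^ (1 / p - 1)))]).toContinuousLinearMap

/-- The open unit square. -/
def openUnitSquare : Set (ℝ × ℝ) := Ioo 0 1 ×ˢ Ioo 0 1

/-- The part of the open unit `p`-ball inside the open first quadrant. -/
def pBallQuadrant (p : ℝ) : Set (ℝ × ℝ) := {q | 0 < q.1 ∧ 0 < q.2 ∧ q.1 ^ p + q.2 ^ p < 1}

theorem hasFDerivAt_pPolar {p : ℝ} {z : ℝ × ℝ} (hz : z ∈ openUnitSquare) :
    HasFDerivAt (pPolar p) (fderivPPolar p z) z := by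
  obtain ⟨-, h0, h1⟩ := hz
  unfold fderivPPolar
  rw [Matrix.toLin_finTwoProd_toContinuousLinearMap]
  have e1 : HasDerivAt (fun t : ℝ => t ^ (1 / p)) (1 / p * z.2 ^ (1 / p - 1)) z.2 :=
    Real.hasDerivAt_rpow_const (Or.inl h0.ne')
  have e2 : HasDerivAt (fun t : ℝ => (1 - t) ^ (1 / p))
      (-(1 / p * (1 - z.2) ^ (1 / p - 1))) z.2 := by
    have := (((hasDerivAt_id z.2).const_sub 1).rpow_const (p := 1 / p)
      (Or.inl (sub_pos.2 h1).ne'))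
    convert! this using 1
    simp
  convert! HasFDerivAt.prodMk (𝕜 := ℝ)
      (hasFDerivAt_fst.mul (e1.comp_hasFDerivAt z hasFDerivAt_snd))
      (hasFDerivAt_fst.mul (e2.comp_hasFDerivAt z hasFDerivAt_snd)) using 2 <;>
  simp [smul_smul, add_comm, smul_neg, neg_smul _ (ContinuousLinearMap.snd ℝ ℝ ℝ)]

/-- The two products in the determinant share the factor t^(1/p-1) (1-t)^(1/p-1), and their
remaining factors add up to t + (1 - t) = 1. -/
theorem abs_det_fderivPPolar {p : ℝ} (hp : 0 < p) {z : ℝ × ℝ} (hz : z ∈ openUnitSquare) :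
    |(fderivPPolar p z).det| =
      z.1 / p * (z.2 ^ (1 / p - 1) * (1 - z.2) ^ (1 / p - 1)) := by
  obtain ⟨⟨hτ, -⟩, h0, h1⟩ := hz
  have h1' := sub_pos.2 h1
  have h : (fderivPPolar p z).det =
      -(z.1 / p * (z.2 ^ (1 / p - 1) * (1 - z.2) ^ (1 / p - 1))) := by
    unfold fderivPPolar
    simp only [LinearMap.det_toContinuousLinearMap, LinearMap.det_toLin, Matrix.det_fin_two_of]
    have a1 : z.2 ^ (1 / p) = z.2 * z.2 ^ (1 / p - 1) := by
      rw [Real.rpow_sub_one h0.ne']; field_simp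
    have a2 : (1 - z.2) ^ (1 / p) = (1 - z.2) * (1 - z.2) ^ (1 / p - 1) := by
      rw [Real.rpow_sub_one h1'.ne']; field_simp
    rw [a1, a2]
    ring
  rw [h, abs_neg, abs_of_nonneg]
  positivity

theorem rpow_add_rpow_pPolar {p : ℝ} (hp : 0 < p) {z : ℝ × ℝ} (hz : z ∈ openUnitSquare) :
    (pPolar p z).1 ^ p + (pPolar p z).2 ^ p = z.1 ^ p := by
  obtain ⟨⟨hτ, -⟩, h0, h1⟩ := hz
  have h1' := sub_pos.2 h1
  simp only [pPolar]
  rw [Real.mul_rpow hτ.le (by positivity), Real.mul_rpow hτ.le (by positivity),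
    ← Real.rpow_mul h0.le, ← Real.rpow_mul h1'.le, one_div_mul_cancel hp.ne', Real.rpow_one,
    Real.rpow_one]
  ring

theorem injOn_pPolar {p : ℝ} (hp : 0 < p) : InjOn (pPolar p) openUnitSquare := by
  intro z hz w hw h
  have h1 : z.1 = w.1 := by
    have := rpow_add_rpow_pPolar hp hz
    rw [h, rpow_add_rpow_pPolar hp hw] at this
    exact ((Real.rpow_left_inj hw.1.1.le hz.1.1.le hp.ne').1 this).symm
  refine Prod.ext h1 ?_
  have h2 := congrArg Prod.fst h
  simp only [pPolar, h1] at h2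
  have h3 := mul_left_cancel₀ hw.1.1.ne' h2
  exact (Real.rpow_left_inj hz.2.1.le hw.2.1.le (one_div_ne_zero hp.ne')).1 h3

theorem image_pPolar {p : ℝ} (hp : 0 < p) : pPolar p '' openUnitSquare = pBallQuadrant p := by
  ext q
  constructor
  · rintro ⟨z, hz, rfl⟩
    have h := rpow_add_rpow_pPolar hp hz
    obtain ⟨⟨hτ, hτ1⟩, h0, h1⟩ := hz
    have h1' := sub_pos.2 h1
    refine ⟨?_, ?_, ?_⟩
    · simp only [pPolar]; positivity
    · simp only [pPolar]; positivity
    · rw [h]; exact Real.rpow_lt_one hτ.le hτ1 hp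
  · rintro ⟨ha, hb, hab⟩
    set r := q.1 ^ p + q.2 ^ p with hr
    have hap : 0 < q.1 ^ p := by positivity
    have hbp : 0 < q.2 ^ p := by positivity
    have hr0 : 0 < r := by positivity
    have hr1 : r ^ (1 / p) ≠ 0 := by positivity
    have key {a : ℝ} (ha : 0 < a) : r ^ (1 / p) * (a ^ p / r) ^ (1 / p) = a := by
      rw [Real.div_rpow (by positivity) hr0.le, ← Real.rpow_mul ha.le, mul_one_div_cancel hp.ne',
        Real.rpow_one]
      field_simp
    -- The inverse map: τ is the p-norm of q, and t is the share of the first coordinate in r = τ^p.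
    refine ⟨(r ^ (1 / p), q.1 ^ p / r), ⟨⟨by positivity, ?_⟩, by positivity, ?_⟩, ?_⟩
    · exact Real.rpow_lt_one hr0.le hab (by positivity)
    · simp only
      rw [div_lt_one hr0]
      linarith
    · simp only [pPolar]
      rw [show 1 - q.1 ^ p / r = q.2 ^ p / r by rw [hr]; field_simp; ring, key ha, key hb]

theorem measurableSet_openUnitSquare : MeasurableSet openUnitSquare :=
  measurableSet_Ioo.prod measurableSet_Ioo

theorem integrableOn_pBallQuadrant_iff {p : ℝ} (hp : 0 < p) (h : ℝ × ℝ → ℝ) :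
    IntegrableOn h (pBallQuadrant p) ↔ IntegrableOn (fun z =>
      z.1 / p * (z.2 ^ (1 / p - 1) * (1 - z.2) ^ (1 / p - 1)) * h (pPolar p z))
      openUnitSquare := by
  rw [← image_pPolar hp, integrableOn_image_iff_integrableOn_abs_det_fderiv_smul volume
    measurableSet_openUnitSquare (fun z hz => (hasFDerivAt_pPolar hz).hasFDerivWithinAt)
    (injOn_pPolar hp)]
  refine integrableOn_congr_fun (fun z hz => ?_) measurableSet_openUnitSquare
  simp only [abs_det_fderivPPolar hp hz, smul_eq_mul]

theorem setIntegral_pBallQuadrant {p : ℝ} (hp : 0 < p) (h : ℝ × ℝ → ℝ) :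
    ∫ q in pBallQuadrant p, h q = ∫ z in openUnitSquare,
      z.1 / p * (z.2 ^ (1 / p - 1) * (1 - z.2) ^ (1 / p - 1)) * h (pPolar p z) := by
  rw [← image_pPolar hp, integral_image_eq_integral_abs_det_fderiv_smul volume
    measurableSet_openUnitSquare (fun z hz => (hasFDerivAt_pPolar hz).hasFDerivWithinAt)
    (injOn_pPolar hp)]
  refine setIntegral_congr_fun measurableSet_openUnitSquare (fun z hz => ?_)
  simp only [abs_det_fderivPPolar hp hz, smul_eq_mul]

/-! ### Folding onto the first quadrant, and integrability of the factors -/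

theorem map_abs_volume :
    (volume : Measure ℝ).map (fun t => |t|) = (2 : ℝ≥0∞) • volume.restrict (Ioi (0 : ℝ)) := by
  ext s hs
  have hm : Measurable fun t : ℝ => |t| := continuous_abs.measurable
  rw [Measure.map_apply hm hs, Measure.smul_apply, Measure.restrict_apply hs,
    ← measure_sdiff_add_inter ((fun t : ℝ => |t|) ⁻¹' s) (measurableSet_Ioi (a := (0 : ℝ)))]
  have h1 : (fun t : ℝ => |t|) ⁻¹' s ∩ Ioi 0 = s ∩ Ioi 0 := by
    ext t
    simp only [mem_inter_iff, mem_preimage, mem_Ioi, and_congr_left_iff]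
    intro ht
    rw [abs_of_pos ht]
  have h2 : volume ((fun t : ℝ => |t|) ⁻¹' s \ Ioi 0) = volume (s ∩ Ioi 0) := by
    have e : (fun t : ℝ => |t|) ⁻¹' s \ Ioi 0 =ᵐ[volume] Neg.neg ⁻¹' (s ∩ Ioi 0) := by
      have : ∀ᵐ t : ℝ, t ≠ 0 := by simp [ae_iff]
      filter_upwards [this] with t ht
      apply propext
      show (|t| ∈ s ∧ ¬ 0 < t) ↔ (-t ∈ s ∧ 0 < -t)
      rcases lt_or_gt_of_ne ht with h | h
      · simp [abs_of_neg h, h, h.le]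
      · simp [h, h.le]
    exact (measure_congr e).trans (Measure.measure_preimage_neg _ _)
  rw [h1, h2, smul_eq_mul, two_mul]

theorem map_abs_abs_volume :
    (volume : Measure (ℝ × ℝ)).map (fun z => (|z.1|, |z.2|)) =
      (4 : ℝ≥0∞) • volume.restrict (Ioi (0 : ℝ) ×ˢ Ioi (0 : ℝ)) := by
  have hm : Measurable fun t : ℝ => |t| := continuous_abs.measurable
  have := Measure.map_prod_map (volume : Measure ℝ) (volume : Measure ℝ) hm hm
  rw [map_abs_volume, Measure.prod_smul_left, Measure.prod_smul_right, smul_smul,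
    Measure.prod_restrict] at this
  rw [Measure.volume_eq_prod]
  change Measure.map (Prod.map _ _) _ = _
  rw [← this]
  norm_num

theorem integrable_comp_abs_abs {K : ℝ × ℝ → ℝ} (hK : Measurable K)
    (h : IntegrableOn K (Ioi 0 ×ˢ Ioi 0)) : Integrable (fun z : ℝ × ℝ => K (|z.1|, |z.2|)) := by
  have hm : Measurable fun z : ℝ × ℝ => (|z.1|, |z.2|) := by fun_prop
  refine (integrable_map_measure hK.aestronglyMeasurable hm.aemeasurable).1 ?_
  rw [map_abs_abs_volume]
  exact h.smul_measure (by simp)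

theorem integral_comp_abs_abs {K : ℝ × ℝ → ℝ} (hK : Measurable K) :
    ∫ z : ℝ × ℝ, K (|z.1|, |z.2|) = 4 * ∫ z in Ioi 0 ×ˢ Ioi 0, K z := by
  have hm : Measurable fun z : ℝ × ℝ => (|z.1|, |z.2|) := by fun_prop
  rw [← integral_map (f := K) hm.aemeasurable hK.aestronglyMeasurable, map_abs_abs_volume,
    integral_smul_measure]
  simp

theorem integrableOn_rpow_mul_one_sub_rpow {a b : ℝ} (ha : 0 < a) (hb : 0 < b) :
    IntegrableOn (fun t : ℝ => t ^ (a - 1) * (1 - t) ^ (b - 1)) (Ioo 0 1) := by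
  have h := Complex.betaIntegral_convergent (u := a) (v := b) (by simpa) (by simpa)
  rw [intervalIntegrable_iff_integrableOn_Ioo_of_le zero_le_one] at h
  refine IntegrableOn.congr_fun h.re (fun t ht => ?_) measurableSet_Ioo
  have h1 := sub_pos.2 ht.2
  have e1 : ((t : ℂ) ^ ((a : ℂ) - 1)) = ((t ^ (a - 1) : ℝ) : ℂ) := by
    rw [Complex.ofReal_cpow ht.1.le]; push_cast; rfl
  have e2 : ((1 - t : ℂ) ^ ((b : ℂ) - 1)) = (((1 - t) ^ (b - 1) : ℝ) : ℂ) := by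
    rw [Complex.ofReal_cpow h1.le]; push_cast; rfl
  simp only [e1, e2]
  rw [← Complex.ofReal_mul]
  simp

theorem integrableOn_mul_one_sub_rpow {p β : ℝ} (hp : 0 < p) (hβ : -1 < β) :
    IntegrableOn (fun τ : ℝ => τ * (1 - τ ^ p) ^ β) (Ioo 0 1) := by
  have hmeas : Measurable (fun τ : ℝ => τ * (1 - τ ^ p) ^ β) := by fun_prop
  have hr : ∀ τ ∈ Ioo (0 : ℝ) 1, 0 < 1 - τ ^ p ∧ 1 - τ ^ p ≤ 1 := fun τ hτ =>
    ⟨sub_pos.2 (Real.rpow_lt_one hτ.1.le hτ.2 hp), by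
      have := Real.rpow_nonneg hτ.1.le p
      linarith⟩
  rcases le_or_gt 0 β with h | h
  · refine Integrable.mono' (g := fun _ => (1 : ℝ)) (integrable_const _)
      hmeas.aestronglyMeasurable ?_
    filter_upwards [ae_restrict_mem measurableSet_Ioo] with τ hτ
    obtain ⟨h1, h2⟩ := hr τ hτ
    have := Real.rpow_le_one h1.le h2 h
    rw [Real.norm_of_nonneg (mul_nonneg hτ.1.le (Real.rpow_nonneg h1.le _))]
    exact mul_le_one₀ hτ.2.le (Real.rpow_nonneg h1.le _) this
  · have hb := (integrableOn_rpow_mul_one_sub_rpow one_pos (b := β + 1) (by linarith)).const_mul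
      ((min 1 p) ^ β)
    refine Integrable.mono' hb hmeas.aestronglyMeasurable ?_
    filter_upwards [ae_restrict_mem measurableSet_Ioo] with τ hτ
    obtain ⟨h1, h2⟩ := hr τ hτ
    have hc : 0 < min 1 p := by positivity
    -- A linear lower bound at τ = 1 reduces the case β < 0 to a beta integral: τ^p ≤ τ if p ≥ 1,
    -- Bernoulli's inequality if p ≤ 1.
    have h3 : min 1 p * (1 - τ) ≤ 1 - τ ^ p := by
      rcases le_total 1 p with hp1 | hp1
      · rw [min_eq_left hp1]
        have := Real.rpow_le_rpow_of_exponent_ge hτ.1 hτ.2.le hp1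
        rw [Real.rpow_one] at this
        linarith
      · rw [min_eq_right hp1]
        have := rpow_one_add_le_one_add_mul_self (s := τ - 1) (by linarith [hτ.1]) hp.le hp1
        rw [add_sub_cancel] at this
        linarith
    have h4 := sub_pos.2 hτ.2
    have h5 := Real.rpow_le_rpow_of_nonpos (mul_pos hc h4) h3 h.le
    rw [Real.mul_rpow hc.le h4.le] at h5
    rw [Real.norm_of_nonneg (mul_nonneg hτ.1.le (Real.rpow_nonneg h1.le _))]
    simp only [sub_self, Real.rpow_zero, one_mul, add_sub_cancel_right]
    refine le_trans ?_ h5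
    exact mul_le_of_le_one_left (Real.rpow_nonneg h1.le _) hτ.2.le

/-! ### The weight and its Fourier transform -/

/-- The Bochner–Riesz type weight `(s - a^p - b^p)_+^β / Γ(β + 1)` on pairs of reals. -/
noncomputable def rieszWeight (p β s : ℝ) (q : ℝ × ℝ) : ℝ :=
  {q : ℝ × ℝ | q.1 ^ p + q.2 ^ p < s}.indicator
    (fun q => 1 / Real.Gamma (β + 1) * (s - (q.1 ^ p + q.2 ^ p)) ^ β) q

/-- The radial (for the `p`-norm) Bochner–Riesz type weight on the plane. -/
noncomputable def planeWeight (p β s : ℝ) (ξ : Plane) : ℝ := rieszWeight p β s (|ξ 0|, |ξ 1|)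

theorem pNorm_rpow {p : ℝ} (hp : 0 < p) (x : Plane) : pNorm p x ^ p = |x 0| ^ p + |x 1| ^ p := by
  rw [pNorm, ← Real.rpow_mul (by positivity), one_div_mul_cancel hp.ne', Real.rpow_one]

theorem planeWeight_eq_indicator {p : ℝ} (hp : 0 < p) (β s : ℝ) (ξ : Plane) :
    planeWeight p β s ξ = {ξ : Plane | pNorm p ξ ^ p < s}.indicator
      (fun ξ => 1 / Real.Gamma (β + 1) * (s - pNorm p ξ ^ p) ^ β) ξ := by
  simp only [planeWeight, rieszWeight, indicator, mem_ofPred_eq, pNorm_rpow hp]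

theorem measurable_rieszWeight (p β s : ℝ) : Measurable (rieszWeight p β s) := by
  have hm : Measurable fun q : ℝ × ℝ => q.1 ^ p + q.2 ^ p := by fun_prop
  exact Measurable.indicator (by fun_prop) (measurableSet_lt hm measurable_const)

theorem measurable_pNorm (p : ℝ) : Measurable (pNorm p) := by
  unfold pNorm
  fun_prop

theorem integralD_eq_fourierInv {p : ℝ} (hp : 0 < p) (β s : ℝ) (x : Plane) :
    integralD p β s x = 𝓕⁻ (fun ξ => (planeWeight p β s ξ : ℂ)) x := by
  have hS : MeasurableSet {ξ : Plane | pNorm p ξ ^ p < s} :=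
    measurableSet_lt ((measurable_pNorm p).pow_const p) measurable_const
  rw [integralD, fourierInv_plane, ← integral_const_mul, ← integral_indicator hS]
  refine integral_congr_ae (Eventually.of_forall fun ξ => ?_)
  simp only [planeWeight_eq_indicator hp, indicator]
  split_ifs
  · push_cast
    ring
  · simp

theorem latticeD_eq_tsum {p : ℝ} (hp : 0 < p) (β s : ℝ) (x : Plane) :
    latticeD p β s x = ∑' m : Fin 2 → ℤ,
      (planeWeight p β s (latticePoint m) : ℂ) * planeExp x (latticePoint m) := by
  rw [latticeD, ← tsum_mul_left]
  refine (tsum_subtype {m : Fin 2 → ℤ | pNorm p (latticePoint m) ^ p < s} (fun m =>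
    1 / (Real.Gamma (β + 1) : ℂ) * ((((s - pNorm p (latticePoint m) ^ p) ^ β : ℝ) : ℂ) *
      planeExp x (latticePoint m)))).trans (tsum_congr fun m => ?_)
  simp only [planeWeight_eq_indicator hp, indicator, mem_ofPred_eq]
  split_ifs
  · push_cast
    ring
  · simp

theorem pBallQuadrant_subset (p : ℝ) : pBallQuadrant p ⊆ Ioi 0 ×ˢ Ioi 0 :=
  fun _ hq => ⟨hq.1, hq.2.1⟩

theorem rieszWeight_eq_zero {p β : ℝ} {q : ℝ × ℝ}
    (hq : q ∈ (Ioi 0 ×ˢ Ioi 0 : Set (ℝ × ℝ)) \ pBallQuadrant p) : rieszWeight p β 1 q = 0 := by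
  exact indicator_of_notMem (s := {q : ℝ × ℝ | q.1 ^ p + q.2 ^ p < 1})
    (fun h => hq.2 ⟨hq.1.1, hq.1.2, h⟩) _

theorem rieszWeight_pPolar {p : ℝ} (hp : 0 < p) (β : ℝ) {z : ℝ × ℝ} (hz : z ∈ openUnitSquare) :
    rieszWeight p β 1 (pPolar p z) = 1 / Real.Gamma (β + 1) * (1 - z.1 ^ p) ^ β := by
  have h : pPolar p z ∈ {q : ℝ × ℝ | q.1 ^ p + q.2 ^ p < 1} := by
    rw [mem_ofPred_eq, rpow_add_rpow_pPolar hp hz]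
    exact Real.rpow_lt_one hz.1.1.le hz.1.2 hp
  rw [rieszWeight, indicator_of_mem h, rpow_add_rpow_pPolar hp hz]

theorem integrableOn_openUnitSquare {p β : ℝ} (hp : 0 < p) (hβ : -1 < β) :
    IntegrableOn (fun z : ℝ × ℝ => z.1 * (1 - z.1 ^ p) ^ β *
      (z.2 ^ (1 / p - 1) * (1 - z.2) ^ (1 / p - 1))) openUnitSquare := by
  have := (integrableOn_mul_one_sub_rpow hp hβ).mul_prod
    (integrableOn_rpow_mul_one_sub_rpow (one_div_pos.2 hp) (one_div_pos.2 hp))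
  rwa [Measure.prod_restrict] at this

theorem integrableOn_rieszWeight {p β : ℝ} (hp : 0 < p) (hβ : -1 < β) :
    IntegrableOn (rieszWeight p β 1) (Ioi 0 ×ˢ Ioi 0) := by
  refine IntegrableOn.of_forall_sdiff_eq_zero (s := pBallQuadrant p) ?_
    (measurableSet_Ioi.prod measurableSet_Ioi) fun q hq => rieszWeight_eq_zero hq
  rw [integrableOn_pBallQuadrant_iff hp]
  refine IntegrableOn.congr_fun ((integrableOn_openUnitSquare hp hβ).const_mul
    (1 / p * (1 / Real.Gamma (β + 1)))) (fun z hz => ?_) measurableSet_openUnitSquare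
  simp only [rieszWeight_pPolar hp β hz]
  ring

theorem integrable_planeWeight {p β : ℝ} (hp : 0 < p) (hβ : -1 < β) :
    Integrable (fun ξ => (planeWeight p β 1 ξ : ℂ)) :=
  Integrable.ofReal <| (integrable_plane_iff (fun q => rieszWeight p β 1 (|q.1|, |q.2|))).2 <|
    integrable_comp_abs_abs (measurable_rieszWeight p β 1) (integrableOn_rieszWeight hp hβ)

/-- Averaging over the reflections in the two coordinate axes. -/
theorem integral_eq_integral_average_reflections {G : ℝ × ℝ → ℂ} (hG : Integrable G) :
    ∫ q, G q = ∫ q : ℝ × ℝ, (G q + G (-q.1, q.2) + (G (q.1, -q.2) + G (-q.1, -q.2))) / 4 := by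
  have hn : MeasurePreserving (fun t : ℝ => -t) := Measure.measurePreserving_neg volume
  have hi : MeasurePreserving (fun t : ℝ => t) := MeasurePreserving.id volume
  have e1 : MeasurePreserving (fun q : ℝ × ℝ => (-q.1, q.2)) := hn.prod hi
  have e2 : MeasurePreserving (fun q : ℝ × ℝ => (q.1, -q.2)) := hi.prod hn
  have e3 : MeasurePreserving (fun q : ℝ × ℝ => (-q.1, -q.2)) := hn.prod hn
  have m1 : MeasurableEmbedding (fun q : ℝ × ℝ => (-q.1, q.2)) :=
    ((MeasurableEquiv.neg ℝ).prodCongr (MeasurableEquiv.refl ℝ)).measurableEmbedding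
  have m2 : MeasurableEmbedding (fun q : ℝ × ℝ => (q.1, -q.2)) :=
    ((MeasurableEquiv.refl ℝ).prodCongr (MeasurableEquiv.neg ℝ)).measurableEmbedding
  have m3 : MeasurableEmbedding (fun q : ℝ × ℝ => (-q.1, -q.2)) :=
    ((MeasurableEquiv.neg ℝ).prodCongr (MeasurableEquiv.neg ℝ)).measurableEmbedding
  have i1 := (e1.integrable_comp_emb m1).2 hG
  have i2 := (e2.integrable_comp_emb m2).2 hG
  have i3 := (e3.integrable_comp_emb m3).2 hG
  have h1 := e1.integral_comp m1 G
  have h2 := e2.integral_comp m2 G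
  have h3 := e3.integral_comp m3 G
  simp only [Function.comp_def] at i1 i2 i3
  have h4 : ∫ q : ℝ × ℝ, (G q + G (-q.1, q.2) + (G (q.1, -q.2) + G (-q.1, -q.2))) =
      4 * ∫ q, G q := by
    have i4 : Integrable fun q : ℝ × ℝ => G q + G (-q.1, q.2) := hG.add i1
    have i5 : Integrable fun q : ℝ × ℝ => G (q.1, -q.2) + G (-q.1, -q.2) := i2.add i3
    rw [integral_add i4 i5, integral_add hG i1, integral_add i2 i3, h1, h2, h3]
    ring
  rw [integral_div, h4]
  ring

/-- The weight is even in each coordinate, so averaging over reflections replaces exponentials by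
cosines; the integrand then depends only on |ξ₁|, |ξ₂|. -/
theorem fourierInv_planeWeight_eq_setIntegral {p β : ℝ} (hp : 0 < p) (hβ : -1 < β) (x : Plane) :
    𝓕⁻ (fun ξ => (planeWeight p β 1 ξ : ℂ)) x =
      ((4 * ∫ q in Ioi 0 ×ˢ Ioi 0, rieszWeight p β 1 q *
        (Real.cos (2 * Real.pi * x 0 * q.1) * Real.cos (2 * Real.pi * x 1 * q.2)) : ℝ) : ℂ) := by
  set c0 := 2 * Real.pi * x 0
  set c1 := 2 * Real.pi * x 1
  let e (c t : ℝ) : ℂ := Complex.exp (c * t * Complex.I)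
  let G : ℝ × ℝ → ℂ := fun q => (rieszWeight p β 1 (|q.1|, |q.2|) : ℂ) * (e c0 q.1 * e c1 q.2)
  have hw : Integrable (fun q : ℝ × ℝ => (rieszWeight p β 1 (|q.1|, |q.2|) : ℂ)) :=
    (integrable_comp_abs_abs (measurable_rieszWeight p β 1)
      (integrableOn_rieszWeight hp hβ)).ofReal
  have he (c t : ℝ) : ‖e c t‖ = 1 := by
    simp only [e]
    rw [← Complex.ofReal_mul]
    exact Complex.norm_exp_ofReal_mul_I _
  have hG : Integrable G := by
    refine hw.mul_bdd (c := 1) (by fun_prop) (Eventually.of_forall fun q => ?_)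
    rw [norm_mul, he, he, one_mul]
  have hcos (c t : ℝ) : e c t + e c (-t) = 2 * (Real.cos (c * t) : ℂ) := by
    simp only [e, Complex.ofReal_cos, Complex.cos]
    push_cast
    ring_nf
  have h1 : 𝓕⁻ (fun ξ => (planeWeight p β 1 ξ : ℂ)) x = ∫ q, G q := by
    rw [fourierInv_plane, ← integral_plane]
    refine integral_congr_ae (Eventually.of_forall fun ξ => ?_)
    simp only [G, e, planeExp_eq_mul, planeWeight, c0, c1]
    push_cast
    ring_nf
  have hm : Measurable fun q : ℝ × ℝ => rieszWeight p β 1 q *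
      (Real.cos (c0 * q.1) * Real.cos (c1 * q.2)) :=
    (measurable_rieszWeight p β 1).mul (by fun_prop)
  rw [h1, integral_eq_integral_average_reflections hG, ← integral_comp_abs_abs hm,
    ← integral_complex_ofReal]
  refine integral_congr_ae (Eventually.of_forall fun q => ?_)
  have habs (c t : ℝ) : Real.cos (c * |t|) = Real.cos (c * t) := by
    rcases abs_choice t with h | h <;> rw [h]
    rw [mul_neg, Real.cos_neg]
  simp only [G, abs_neg, habs]
  have : ∀ A : ℂ, (A * (e c0 q.1 * e c1 q.2) + A * (e c0 (-q.1) * e c1 q.2) +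
      (A * (e c0 q.1 * e c1 (-q.2)) + A * (e c0 (-q.1) * e c1 (-q.2)))) / 4 =
      A * ((e c0 q.1 + e c0 (-q.1)) * (e c1 q.2 + e c1 (-q.2))) / 4 := fun A => by ring
  rw [this, hcos, hcos]
  push_cast
  ring

/-- In p-polar coordinates the weight depends on τ alone, and the t-integral is J_0 up to
Γ(1/p)²(p/2)². With the 4 quadrants and the Jacobian's 1/p this leaves the factor p Γ(1/p)². -/
theorem fourierInv_planeWeight {p β : ℝ} (hp : 0 < p) (hβ : -1 < β) (x : Plane) :
    𝓕⁻ (fun ξ => (planeWeight p β 1 ξ : ℂ)) x =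
      ((p * Real.Gamma (1 / p) ^ 2 / Real.Gamma (β + 1) * ∫ τ in (0 : ℝ)..1,
        genBesselZero p (τ • (2 * Real.pi) • x) * τ * (1 - τ ^ p) ^ β : ℝ) : ℂ) := by
  rw [fourierInv_planeWeight_eq_setIntegral hp hβ]
  congr 1
  set c0 := 2 * Real.pi * x 0 with hc0
  set c1 := 2 * Real.pi * x 1 with hc1
  have hG : Real.Gamma (1 / p) ≠ 0 := (Real.Gamma_pos_of_pos (by positivity)).ne'
  rw [setIntegral_eq_of_subset_of_forall_sdiff_eq_zero
    (measurableSet_Ioi.prod measurableSet_Ioi) (pBallQuadrant_subset p)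
    (fun q hq => by rw [rieszWeight_eq_zero hq, zero_mul]), setIntegral_pBallQuadrant hp]
  let k : ℝ × ℝ → ℝ := fun z => z.1 * (1 - z.1 ^ p) ^ β *
      (z.2 ^ (1 / p - 1) * (1 - z.2) ^ (1 / p - 1)) *
      (Real.cos (c0 * (pPolar p z).1) * Real.cos (c1 * (pPolar p z).2))
  have hk : IntegrableOn k openUnitSquare := by
    refine (integrableOn_openUnitSquare hp hβ).mul_bdd (c := 1) ?_ ?_
    · unfold pPolar
      exact Measurable.aestronglyMeasurable (by fun_prop)
    · refine Eventually.of_forall fun z => ?_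
      rw [norm_mul]
      exact mul_le_one₀ (Real.abs_cos_le_one _) (norm_nonneg _) (Real.abs_cos_le_one _)
  have e1 : ∫ z in openUnitSquare, z.1 / p * (z.2 ^ (1 / p - 1) * (1 - z.2) ^ (1 / p - 1)) *
      (rieszWeight p β 1 (pPolar p z) *
        (Real.cos (c0 * (pPolar p z).1) * Real.cos (c1 * (pPolar p z).2))) =
      1 / p * (1 / Real.Gamma (β + 1)) * ∫ z in openUnitSquare, k z := by
    rw [← integral_const_mul]
    refine setIntegral_congr_fun measurableSet_openUnitSquare fun z hz => ?_
    simp only [rieszWeight_pPolar hp β hz, k]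
    ring
  have e2 : ∫ z in openUnitSquare, k z = ∫ τ in Ioo (0 : ℝ) 1, ∫ t in Ioo (0 : ℝ) 1, k (τ, t) :=
    setIntegral_prod k hk
  have e3 : ∀ τ : ℝ, ∫ t in Ioo (0 : ℝ) 1, k (τ, t) = Real.Gamma (1 / p) ^ 2 * (p / 2) ^ 2 *
      (genBesselZero p (τ • (2 * Real.pi) • x) * τ * (1 - τ ^ p) ^ β) := by
    intro τ
    have : ∫ t in Ioo (0 : ℝ) 1, k (τ, t) = τ * (1 - τ ^ p) ^ β *
        ∫ t in (0 : ℝ)..1, Real.cos ((τ • (2 * Real.pi) • x) 0 * t ^ (1 / p)) *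
          Real.cos ((τ • (2 * Real.pi) • x) 1 * (1 - t) ^ (1 / p)) *
          t ^ (1 / p - 1) * (1 - t) ^ (1 / p - 1) := by
      rw [intervalIntegral.integral_of_le zero_le_one, integral_Ioc_eq_integral_Ioo,
        ← integral_const_mul]
      refine setIntegral_congr_fun measurableSet_Ioo fun t _ => ?_
      simp only [k, pPolar, PiLp.smul_apply, smul_eq_mul, c0, c1]
      ring_nf
    rw [this, genBesselZero]
    field_simp
  rw [e1, e2]
  simp only [e3]
  rw [integral_const_mul, intervalIntegral.integral_of_le zero_le_one,
    integral_Ioc_eq_integral_Ioo]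
  field_simp
  ring

/-! ### Continuity, support and scaling of the weight -/

theorem continuous_fourierInv {f : Plane → ℂ} (hf : Integrable f) : Continuous (𝓕⁻ f) :=
  VectorFourier.fourierIntegral_continuous (L := -innerₗ Plane) Real.continuous_fourierChar
    (by simpa using! continuous_inner.neg) hf

theorem integrable_fourier_of_fourierInv {f : Plane → ℂ} (hf : Integrable (𝓕⁻ f)) :
    Integrable (𝓕 f) := by
  have := hf.comp_neg
  simpa [Real.fourierInv_eq_fourier_neg] using this

theorem continuous_abs_rpow_add {p : ℝ} (hp : 0 < p) :
    Continuous fun ξ : Plane => |ξ 0| ^ p + |ξ 1| ^ p := by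
  have h (i : Fin 2) : Continuous fun ξ : Plane => |ξ i| ^ p :=
    Continuous.rpow_const (by fun_prop) fun _ => Or.inr hp.le
  exact (h 0).add (h 1)

theorem planeWeight_of_lt {p β s : ℝ} {ξ : Plane} (h : |ξ 0| ^ p + |ξ 1| ^ p < s) :
    planeWeight p β s ξ = 1 / Real.Gamma (β + 1) * (s - (|ξ 0| ^ p + |ξ 1| ^ p)) ^ β := by
  simp only [planeWeight, rieszWeight, indicator, mem_ofPred_eq, if_pos h]

theorem planeWeight_of_le {p β s : ℝ} {ξ : Plane} (h : s ≤ |ξ 0| ^ p + |ξ 1| ^ p) :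
    planeWeight p β s ξ = 0 := by
  simp only [planeWeight, rieszWeight, indicator, mem_ofPred_eq, if_neg (not_lt.2 h)]

theorem continuousAt_planeWeight {p β s : ℝ} (hp : 0 < p) {ξ : Plane}
    (h : |ξ 0| ^ p + |ξ 1| ^ p ≠ s) : ContinuousAt (planeWeight p β s) ξ := by
  have hc := continuous_abs_rpow_add hp
  rcases lt_or_gt_of_ne h with h | h
  · have : ContinuousAt (fun ξ : Plane =>
        1 / Real.Gamma (β + 1) * (s - (|ξ 0| ^ p + |ξ 1| ^ p)) ^ β) ξ :=
      continuousAt_const.mul ((continuousAt_const.sub hc.continuousAt).rpow_const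
        (Or.inl (sub_pos.2 h).ne'))
    refine this.congr ?_
    filter_upwards [hc.continuousAt.eventually_lt_const h] with z hz
    exact (planeWeight_of_lt hz).symm
  · refine (continuousAt_const (y := (0 : ℝ))).congr ?_
    filter_upwards [hc.continuousAt.eventually_const_lt h] with z hz
    exact (planeWeight_of_le (le_of_lt hz)).symm

/-- Integrability of the Fourier transform rules out the discontinuous weights. -/
theorem pos_of_integrable_fourierInv_planeWeight {p β : ℝ} (hp : 0 < p) (hβ : -1 < β)
    (h : Integrable (𝓕⁻ (fun ξ => (planeWeight p β 1 ξ : ℂ)))) : 0 < β := by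
  by_contra! hβ0
  set f : Plane → ℂ := fun ξ => (planeWeight p β 1 ξ : ℂ) with hf
  have hfi : Integrable f := integrable_planeWeight hp hβ
  have hF := integrable_fourier_of_fourierInv h
  let P : ℝ → Plane := fun r => EuclideanSpace.single 0 r
  have hP : Continuous P := by
    have : Continuous fun r : ℝ => r • (EuclideanSpace.single 0 (1 : ℝ) : Plane) := by fun_prop
    convert! this using 2 with r
    ext i
    fin_cases i <;> simp [P]
  have hN (r : ℝ) (hr : 0 < r) : |P r 0| ^ p + |P r 1| ^ p = r ^ p := by
    simp [P, abs_of_pos hr, Real.zero_rpow hp.ne']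
  -- The continuous representative of the weight along a coordinate ray. It equals the weight for r
  -- > 0, r ≠ 1, and the two one-sided limits at r = 1 contradict each other.
  let u : ℝ → ℝ := fun r => (𝓕⁻ (𝓕 f) (P r)).re
  have hu : Continuous u :=
    Complex.continuous_re.comp ((continuous_fourierInv hF).comp hP)
  have hval (r : ℝ) (hr : 0 < r) (h1 : r ^ p ≠ 1) : u r = planeWeight p β 1 (P r) := by
    have hca : ContinuousAt f (P r) := Complex.continuous_ofReal.continuousAt.comp
      (continuousAt_planeWeight hp (by rwa [hN r hr]))
    simp only [u]
    rw [hfi.fourierInv_fourier_eq hF hca, hf, Complex.ofReal_re]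
  have hG : 0 < Real.Gamma (β + 1) := Real.Gamma_pos_of_pos (by linarith)
  have hleft : 1 / Real.Gamma (β + 1) ≤ u 1 := by
    refine ge_of_tendsto (hu.continuousAt.tendsto.mono_left nhdsWithin_le_nhds :
      Tendsto u (𝓝[<] 1) _) ?_
    filter_upwards [Ioo_mem_nhdsLT (zero_lt_one' ℝ)] with r hr
    have h1 : r ^ p < 1 := Real.rpow_lt_one hr.1.le hr.2 hp
    have h2 : 0 < r ^ p := Real.rpow_pos_of_pos hr.1 p
    rw [hval r hr.1 h1.ne, planeWeight_of_lt (by rwa [hN r hr.1]), hN r hr.1]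
    exact le_mul_of_one_le_right (by positivity)
      (Real.one_le_rpow_of_pos_of_le_one_of_nonpos (sub_pos.2 h1) (by linarith) hβ0)
  have hright : u 1 ≤ 0 := by
    refine le_of_tendsto (hu.continuousAt.tendsto.mono_left nhdsWithin_le_nhds :
      Tendsto u (𝓝[>] 1) _) ?_
    filter_upwards [self_mem_nhdsWithin] with r hr
    have hr0 : 0 < r := zero_lt_one.trans hr
    have h1 : 1 < r ^ p := Real.one_lt_rpow hr hp
    rw [hval r hr0 h1.ne', planeWeight_of_le (by rw [hN r hr0]; exact h1.le)]
  have : 0 < 1 / Real.Gamma (β + 1) := by positivity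
  linarith

theorem continuous_planeWeight {p β s : ℝ} (hp : 0 < p) (hβ : 0 < β) :
    Continuous (planeWeight p β s) := by
  have : planeWeight p β s = fun ξ : Plane =>
      1 / Real.Gamma (β + 1) * (max 0 (s - (|ξ 0| ^ p + |ξ 1| ^ p))) ^ β := by
    ext ξ
    rcases lt_or_ge (|ξ 0| ^ p + |ξ 1| ^ p) s with h | h
    · rw [planeWeight_of_lt h, max_eq_right (sub_pos.2 h).le]
    · rw [planeWeight_of_le h, max_eq_left (sub_nonpos.2 h), Real.zero_rpow hβ.ne', mul_zero]
  rw [this]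
  exact continuous_const.mul ((continuous_const.max (continuous_const.sub
    (continuous_abs_rpow_add hp))).rpow_const fun _ => Or.inr hβ.le)

theorem hasCompactSupport_planeWeight {p β s : ℝ} (hp : 0 < p) :
    HasCompactSupport fun ξ => (planeWeight p β s ξ : ℂ) := by
  refine HasCompactSupport.of_support_subset_isCompact
    (isCompact_closedBall (0 : Plane) (2 * s ^ (1 / p))) fun ξ hξ => ?_
  have h : |ξ 0| ^ p + |ξ 1| ^ p < s := by
    by_contra! h
    exact hξ (by simp [planeWeight_of_le h])
  have hb : ∀ i, |ξ i| ≤ s ^ (1 / p) := by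
    intro i
    have h0 : 0 ≤ |ξ 0| ^ p := by positivity
    have h1 : 0 ≤ |ξ 1| ^ p := by positivity
    have hi : |ξ i| ^ p ≤ s := by fin_cases i <;> simp <;> linarith
    have := Real.rpow_le_rpow (by positivity) hi (one_div_pos.2 hp).le
    rwa [← Real.rpow_mul (abs_nonneg _), mul_one_div_cancel hp.ne', Real.rpow_one] at this
  rw [mem_closedBall_zero_iff]
  have hR : 0 ≤ s ^ (1 / p) := (abs_nonneg _).trans (hb 0)
  refine abs_le_of_sq_le_sq' ?_ (by positivity) |>.2
  rw [EuclideanSpace.real_norm_sq_eq, Fin.sum_univ_two]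
  have h0 := sq_le_sq' (by linarith [abs_le.1 (hb 0)]) (abs_le.1 (hb 0)).2
  have h1 := sq_le_sq' (by linarith [abs_le.1 (hb 1)]) (abs_le.1 (hb 1)).2
  nlinarith

theorem planeWeight_smul {p s : ℝ} (hp : 0 < p) (hs : 0 < s) (β : ℝ) (ξ : Plane) :
    planeWeight p β s (s ^ (1 / p) • ξ) = s ^ β * planeWeight p β 1 ξ := by
  have hN : |(s ^ (1 / p) • ξ) 0| ^ p + |(s ^ (1 / p) • ξ) 1| ^ p =
      s * (|ξ 0| ^ p + |ξ 1| ^ p) := by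
    have h (t : ℝ) : |s ^ (1 / p) * t| ^ p = s * |t| ^ p := by
      rw [abs_mul, abs_of_pos (by positivity), Real.mul_rpow (by positivity) (abs_nonneg _),
        ← Real.rpow_mul hs.le, one_div_mul_cancel hp.ne', Real.rpow_one]
    simp only [PiLp.smul_apply, smul_eq_mul, h]
    ring
  rcases lt_or_ge (|ξ 0| ^ p + |ξ 1| ^ p) 1 with h | h
  · rw [planeWeight_of_lt h, planeWeight_of_lt (by rw [hN]; nlinarith), hN,
      show s - s * (|ξ 0| ^ p + |ξ 1| ^ p) = s * (1 - (|ξ 0| ^ p + |ξ 1| ^ p)) by ring,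
      Real.mul_rpow hs.le (sub_pos.2 h).le]
    ring
  · rw [planeWeight_of_le h, planeWeight_of_le (by rw [hN]; nlinarith), mul_zero]

/-- Dilation by s^(1/p) has Jacobian s^(2/p) and multiplies the weight by s^β. This carries the
integrability hypothesis from s = 1 to every s > 0. -/
theorem fourierInv_planeWeight_scale {p s : ℝ} (hp : 0 < p) (hs : 0 < s) (β : ℝ) (x : Plane) :
    𝓕⁻ (fun ξ => (planeWeight p β s ξ : ℂ)) x =
      ((s ^ (β + 2 / p) : ℝ) : ℂ) *
        𝓕⁻ (fun ξ => (planeWeight p β 1 ξ : ℂ)) (s ^ (1 / p) • x) := by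
  set R := s ^ (1 / p) with hR
  have hR0 : 0 < R := by positivity
  have hR2 : R ^ 2 = s ^ (2 / p) := by
    rw [hR, ← Real.rpow_natCast, ← Real.rpow_mul hs.le]
    congr 1
    push_cast
    ring
  have h := Measure.integral_comp_smul (volume : Measure Plane)
    (fun ξ => (planeWeight p β s ξ : ℂ) * planeExp x ξ) R
  rw [finrank_euclideanSpace_fin, abs_of_pos (by positivity)] at h
  have h2 : ∫ ξ : Plane, (planeWeight p β s (R • ξ) : ℂ) * planeExp x (R • ξ) =
      ((s ^ β : ℝ) : ℂ) * ∫ ξ : Plane, (planeWeight p β 1 ξ : ℂ) * planeExp (R • x) ξ := by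
    rw [← integral_const_mul]
    refine integral_congr_ae (Eventually.of_forall fun ξ => ?_)
    simp only [hR, planeWeight_smul hp hs, planeExp, inner_smul_left, inner_smul_right,
      conj_trivial]
    push_cast
    ring
  rw [h2] at h
  rw [fourierInv_plane, fourierInv_plane, Real.rpow_add hs, ← hR2, Complex.ofReal_mul,
    mul_comm (((s ^ β : ℝ)) : ℂ), mul_assoc, h, Complex.real_smul, ← mul_assoc,
    ← Complex.ofReal_mul, mul_inv_cancel₀ (by positivity), Complex.ofReal_one, one_mul]

/-! ### Bessel quotients as Fourier transforms, and the theorem -/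

theorem pNorm_smul {p c : ℝ} (hp : 0 < p) (hc : 0 ≤ c) (y : Plane) :
    pNorm p (c • y) = c * pNorm p y := by
  have h (t : ℝ) : |c * t| ^ p = c ^ p * |t| ^ p := by
    rw [abs_mul, abs_of_nonneg hc, Real.mul_rpow hc (abs_nonneg _)]
  simp only [pNorm, PiLp.smul_apply, smul_eq_mul, h]
  rw [← mul_add, Real.mul_rpow (by positivity) (by positivity), ← Real.rpow_mul hc,
    mul_one_div_cancel hp.ne', Real.rpow_one]

theorem pNorm_pos {p : ℝ} {y : Plane} (hy : y ≠ 0) : 0 < pNorm p y := by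
  have : y 0 ≠ 0 ∨ y 1 ≠ 0 := by
    by_contra! h
    refine hy (PiLp.ext fun i => ?_)
    fin_cases i
    exacts [h.1, h.2]
  have h : 0 < |y 0| ^ p + |y 1| ^ p := by
    rcases this with h | h
    · have : 0 < |y 0| ^ p := Real.rpow_pos_of_pos (abs_pos.2 h) p
      positivity
    · have : 0 < |y 1| ^ p := Real.rpow_pos_of_pos (abs_pos.2 h) p
      positivity
  exact Real.rpow_pos_of_pos h _

theorem besselQuotient_eq {p β s : ℝ} (hp : 0 < p) (hβ : -1 < β) (hs : 0 < s) {y : Plane}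
    (hy : y ≠ 0) :
    (((s ^ (β + 2 / p) * p ^ (β + 1) * Real.Gamma (1 / p) ^ 2 *
      besselQuotient p (β + 1) s y : ℝ)) : ℂ) = 𝓕⁻ (fun ξ => (planeWeight p β s ξ : ℂ)) y := by
  have hc : 0 < 2 * Real.pi * s ^ (1 / p) := by positivity
  have hn : 0 < (2 * Real.pi * s ^ (1 / p) * pNorm p y) ^ (β + 1) :=
    Real.rpow_pos_of_pos (mul_pos hc (pNorm_pos hy)) _
  have hG : Real.Gamma (β + 1) ≠ 0 := (Real.Gamma_pos_of_pos (by linarith)).ne'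
  have hpβ : p ^ β ≠ 0 := by positivity
  rw [fourierInv_planeWeight_scale hp hs, fourierInv_planeWeight hp hβ, ← Complex.ofReal_mul]
  congr 1
  rw [besselQuotient, genBessel, if_pos (by linarith), pNorm_smul hp hc.le, add_sub_cancel_right,
    Real.rpow_add_one hp.ne', smul_smul]
  field_simp

/-- The Fourier transform of an integrable weight is continuous, so the limit at 0 exists and is its
value there. -/
theorem besselQuotientExt_eq {p β s : ℝ} (hp : 0 < p) (hβ : -1 < β) (hs : 0 < s)
    (hw : Integrable fun ξ => (planeWeight p β s ξ : ℂ)) (y : Plane) :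
    (((s ^ (β + 2 / p) * p ^ (β + 1) * Real.Gamma (1 / p) ^ 2 *
      besselQuotientExt p (β + 1) s y : ℝ)) : ℂ) =
        𝓕⁻ (fun ξ => (planeWeight p β s ξ : ℂ)) y := by
  set A := s ^ (β + 2 / p) * p ^ (β + 1) * Real.Gamma (1 / p) ^ 2 with hA
  have hA0 : 0 < A := by
    have := Real.Gamma_pos_of_pos (one_div_pos.2 hp)
    positivity
  rcases ne_or_eq y 0 with hy | rfl
  · rw [besselQuotientExt, Function.update_of_ne hy, besselQuotient_eq hp hβ hs hy]
  · have hcont := continuous_fourierInv hw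
    have hlim : Tendsto (fun y : Plane => A * besselQuotient p (β + 1) s y) (𝓝[≠] 0)
        (𝓝 (𝓕⁻ (fun ξ => (planeWeight p β s ξ : ℂ)) 0).re) := by
      refine ((Complex.continuous_re.comp hcont).continuousAt.tendsto.mono_left
        nhdsWithin_le_nhds).congr' ?_
      filter_upwards [self_mem_nhdsWithin] with y hy
      rw [Function.comp_apply, ← besselQuotient_eq hp hβ hs hy, Complex.ofReal_re]
    have hlim' := hlim.const_mul A⁻¹
    simp only [inv_mul_cancel_left₀ hA0.ne'] at hlim'
    rw [besselQuotientExt, Function.update_self, hlim'.limUnder_eq, mul_inv_cancel_left₀ hA0.ne',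
      fourierInv_planeWeight_scale hp hs, fourierInv_planeWeight hp hβ, ← Complex.ofReal_mul,
      Complex.ofReal_re]

theorem sub_latticePoint_ne_zero {x : Plane} (hx : x ∈ torusSquare) {n : Fin 2 → ℤ}
    (hn : n ≠ 0) : x - latticePoint n ≠ 0 := by
  intro h
  refine hn (funext fun i => ?_)
  have h1 : x i = n i := by
    rw [sub_eq_zero.1 h]
    rfl
  obtain ⟨h2, h3⟩ := hx i
  rw [h1] at h2 h3
  have h4 : (-1 : ℝ) < n i := by linarith
  have h5 : (n i : ℝ) < 1 := by linarith
  norm_cast at h4 h5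
  simp only [Pi.zero_apply]
  omega

theorem theorem1p3 (p β : ℝ) (hp : 0 < p) (hβ : -1 < β)
    (hint : Integrable (fun x : Plane => integralD p β 1 x) volume) :
    (∀ s : ℝ, 0 < s → ∀ x : Plane,
      Summable (fun n : {n : Fin 2 → ℤ // n ≠ 0} =>
        besselQuotientExt p (β + 1) s (x - latticePoint n)) ∧
      latticeD p β s x - integralD p β s x =
        ((s ^ (β + 2 / p) * p ^ (β + 1) * Real.Gamma (1 / p) ^ 2 *
          ∑' n : {n : Fin 2 → ℤ // n ≠ 0},
            besselQuotientExt p (β + 1) s (x - latticePoint n) : ℝ) : ℂ)) ∧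
    (∀ s : ℝ, 0 < s → ∀ x ∈ torusSquare,
      Summable (fun n : {n : Fin 2 → ℤ // n ≠ 0} =>
        |besselQuotient p (β + 1) s (x - latticePoint n)|)) := by
  have hint' : Integrable (𝓕⁻ (fun ξ => (planeWeight p β 1 ξ : ℂ))) := by
    simpa only [integralD_eq_fourierInv hp] using! hint
  have hβ0 := pos_of_integrable_fourierInv_planeWeight hp hβ hint'
  have main : ∀ s : ℝ, 0 < s → ∀ x : Plane,
      Summable (fun n : {n : Fin 2 → ℤ // n ≠ 0} =>
        besselQuotientExt p (β + 1) s (x - latticePoint n)) ∧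
      latticeD p β s x - integralD p β s x =
        ((s ^ (β + 2 / p) * p ^ (β + 1) * Real.Gamma (1 / p) ^ 2 *
          ∑' n : {n : Fin 2 → ℤ // n ≠ 0},
            besselQuotientExt p (β + 1) s (x - latticePoint n) : ℝ) : ℂ) := by
    intro s hs x
    have hc : Continuous fun ξ => (planeWeight p β s ξ : ℂ) :=
      Complex.continuous_ofReal.comp (continuous_planeWeight hp hβ0)
    have hcs : HasCompactSupport fun ξ => (planeWeight p β s ξ : ℂ) :=
      hasCompactSupport_planeWeight hp
    have hF : Integrable (𝓕⁻ (fun ξ => (planeWeight p β s ξ : ℂ))) := by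
      have hR : s ^ (1 / p) ≠ 0 := by positivity
      refine ((hint'.comp_smul hR).const_mul ((s ^ (β + 2 / p) : ℝ) : ℂ)).congr
        (Eventually.of_forall fun y => ?_)
      exact (fourierInv_planeWeight_scale hp hs β y).symm
    obtain ⟨hsum, heq⟩ := poisson_summation_of_hasCompactSupport hc hcs hF x
    have hext := besselQuotientExt_eq hp hβ hs (hc.integrable_of_hasCompactSupport hcs)
    set F := 𝓕⁻ (fun ξ => (planeWeight p β s ξ : ℂ)) with hFdef
    set A := s ^ (β + 2 / p) * p ^ (β + 1) * Real.Gamma (1 / p) ^ 2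
    have hA0 : A ≠ 0 := by
      have := Real.Gamma_pos_of_pos (one_div_pos.2 hp)
      positivity
    have hsub : Summable fun n : {n : Fin 2 → ℤ // n ≠ 0} => F (x - latticePoint n) :=
      hsum.of_norm.subtype {n | n ≠ 0}
    have hreal : Summable fun n : {n : Fin 2 → ℤ // n ≠ 0} =>
        A * besselQuotientExt p (β + 1) s (x - latticePoint n) := by
      rw [← Complex.summable_ofReal]
      simpa only [hext] using hsub
    refine ⟨(summable_mul_left_iff hA0).1 hreal, ?_⟩
    rw [latticeD_eq_tsum hp, ← heq, integralD_eq_fourierInv hp, ← hFdef, ← tsum_mul_left,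
      Complex.ofReal_tsum]
    simp only [hext]
    -- Split off n = 0, whose term F(x) cancels `integralD`.
    rw [hsum.of_norm.tsum_eq_add_tsum_ite 0]
    have h0 : x - latticePoint 0 = x := by
      ext i
      simp [latticePoint]
    rw [h0, add_sub_cancel_left]
    refine Eq.trans (tsum_congr fun n => ?_)
      (tsum_subtype {n : Fin 2 → ℤ | n ≠ 0} fun n => F (x - latticePoint n)).symm
    by_cases hn : n = 0 <;> simp [hn]
  refine ⟨main, fun s hs x hx => ((main s hs x).1.abs).congr fun n => ?_⟩
  -- The only lattice point in the square is 0, so x - n never vanishes for n ≠ 0 and the value at 0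
  -- is not used.
  rw [besselQuotientExt, Function.update_of_ne (sub_latticePoint_ne_zero hx n.2)]
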